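/- Let $n\ge 3$, let $(M^n,g)$ be a smooth Riemannian manifold that is locally conformally flat (around every point there are smooth local coordinates in which $g_{ij}=e^{2u}\delta_{ij}$ for some smooth function $u$), and let $F:M\to\mathbb{R}$ be a smooth function such that $(M^n,g,F)$ is a gradient steady Ricci soliton, i.e. the Ricci tensor satisfies $R_{ij}=\nabla_i\nabla_jF$. Let $c$ be a regular value of $F$, let $\Sigma_c=\{x\in M: F(x)=c\}$, and let $p\in\Sigma_c$. Put $e_1=\nabla F/|\nabla F|$ at $p$. Then at $p$ the Ricci tensor $Rc$ either has a unique eigenvalue $\lambda$, or has exactly two distinct eigenvalues $\lambda$ and $\mu$, of multiplicity $1$ and $n-1$ respectively; in either case $e_1$ is an eigenvector with eigenvalue $\lambda$. In other words (with $\mu=\lambda$ in the first case), for every orthonormal basis $e_2,\dots,e_n$ of the tangent space of $\Sigma_c$ at $p$: (i) $Rc(e_1,e_1)=\lambda$; (ii) $Rc(e_1,e_b)=0$ for $b=2,\dots,n$; (iii) $Rc(e_a,e_b)=\mu\,\delta_{ab}$ for $a,b=2,\dots,n$. (No completeness or noncompactness of $(M,g)$ is assumed.) -/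

import Mathlib

open scoped Manifold ContDiff Topology

noncomputable section

namespace SteadySoliton

/-! ### Riemannian geometry in a coordinate domain of `ℝⁿ`

A metric on (an open part of) `ℝⁿ` is a matrix-valued function `G`, with `G x i j = g_{ij}(x)`. -/

section Coordinates

variable {n : ℕ}

/-- The partial derivative `∂_i f` at `x`. -/
def pd (i : Fin n) (f : EuclideanSpace ℝ (Fin n) → ℝ) (x : EuclideanSpace ℝ (Fin n)) : ℝ :=
  fderiv ℝ f x (EuclideanSpace.single i 1)

/-- The Christoffel symbol
`Γ^k_{ij} = ½ g^{kl} (∂_i g_{jl} + ∂_j g_{il} - ∂_l g_{ij})` of the metric `G`. -/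
def christoffel (G : EuclideanSpace ℝ (Fin n) → Matrix (Fin n) (Fin n) ℝ) (k i j : Fin n)
    (x : EuclideanSpace ℝ (Fin n)) : ℝ :=
  (1 / 2) * ∑ l, (G x)⁻¹ k l *
    (pd i (fun y => G y j l) x + pd j (fun y => G y i l) x - pd l (fun y => G y i j) x)

/-- The component `R_{ijk}{}^l` of the curvature tensor, where
`R(∂_i, ∂_j) ∂_k = ∇_i ∇_j ∂_k - ∇_j ∇_i ∂_k = R_{ijk}{}^l ∂_l`. -/
def riemannCoord (G : EuclideanSpace ℝ (Fin n) → Matrix (Fin n) (Fin n) ℝ) (i j k l : Fin n)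
    (x : EuclideanSpace ℝ (Fin n)) : ℝ :=
  pd i (christoffel G l j k) x - pd j (christoffel G l i k) x
    + ∑ m, (christoffel G l i m x * christoffel G m j k x
      - christoffel G l j m x * christoffel G m i k x)

/-- The component `R_{jk} = R_{ijk}{}^i` of the Ricci tensor (positive on round spheres). -/
def ricciCoord (G : EuclideanSpace ℝ (Fin n) → Matrix (Fin n) (Fin n) ℝ) (j k : Fin n)
    (x : EuclideanSpace ℝ (Fin n)) : ℝ :=
  ∑ i, riemannCoord G i j k i x

/-- The component `∇_i ∇_j f = ∂_i ∂_j f - Γ^k_{ij} ∂_k f` of the Hessian of `f`. -/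
def hessCoord (G : EuclideanSpace ℝ (Fin n) → Matrix (Fin n) (Fin n) ℝ)
    (f : EuclideanSpace ℝ (Fin n) → ℝ) (i j : Fin n) (x : EuclideanSpace ℝ (Fin n)) : ℝ :=
  pd i (pd j f) x - ∑ k, christoffel G k i j x * pd k f x

end Coordinates

/-! ### Riemannian manifolds -/

section Manifolds

variable {n : ℕ} {M : Type*} [TopologicalSpace M] [ChartedSpace (EuclideanSpace ℝ (Fin n)) M]
  [IsManifold (𝓡 n) ∞ M]

/-- A smooth Riemannian metric on the `n`-dimensional manifold `M`. -/
abbrev Metric (n : ℕ) (M : Type*) [TopologicalSpace M]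
    [ChartedSpace (EuclideanSpace ℝ (Fin n)) M] [IsManifold (𝓡 n) ∞ M] :=
  Bundle.ContMDiffRiemannianMetric (𝓡 n) ∞ (EuclideanSpace ℝ (Fin n))
    (fun x : M => TangentSpace (𝓡 n) x)

/-- The coordinate vector `∂_i` of the chart `φ`, at the point with coordinates `x`. -/
def coordVec (φ : OpenPartialHomeomorph M (EuclideanSpace ℝ (Fin n))) (i : Fin n)
    (x : EuclideanSpace ℝ (Fin n)) : TangentSpace (𝓡 n) (φ.symm x) :=
  mfderiv (𝓡 n) (𝓡 n) φ.symm x (EuclideanSpace.single i (1 : ℝ) : EuclideanSpace ℝ (Fin n))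

/-- The components `g_{ij} = g(∂_i, ∂_j)` of the metric in the chart `φ`. -/
def coordMetric (g : Metric n M) (φ : OpenPartialHomeomorph M (EuclideanSpace ℝ (Fin n)))
    (x : EuclideanSpace ℝ (Fin n)) : Matrix (Fin n) (Fin n) ℝ :=
  Matrix.of fun i j => g.inner (φ.symm x) (coordVec φ i x) (coordVec φ j x)

/-- The coordinates of the tangent vector `v` in the chart `φ`. -/
def coords (φ : OpenPartialHomeomorph M (EuclideanSpace ℝ (Fin n))) (p : M) :
    TangentSpace (𝓡 n) p →ₗ[ℝ] EuclideanSpace ℝ (Fin n) :=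
  (mfderiv (𝓡 n) (𝓡 n) φ p).toLinearMap

/-- The Ricci tensor `Rc(v, w) = R_{ij} v^i w^j` at `p`, a bilinear form on the tangent space.
As the Ricci tensor does not depend on coordinates, it is evaluated in the preferred chart
at `p`. -/
def ricci (g : Metric n M) (p : M) : LinearMap.BilinForm ℝ (TangentSpace (𝓡 n) p) :=
  LinearMap.mk₂ ℝ
    (fun v w => ∑ i, ∑ j,
      ricciCoord (coordMetric g (chartAt _ p)) i j (chartAt _ p p)
        * coords (chartAt _ p) p v i * coords (chartAt _ p) p w j)
    (by intro v v' w; simp [mul_add, add_mul, Finset.sum_add_distrib])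
    (by intro c v w; simp only [map_smul, PiLp.smul_apply, smul_eq_mul, Finset.mul_sum]
        exact Finset.sum_congr rfl fun i _ => Finset.sum_congr rfl fun j _ => by ring)
    (by intro v w w'; simp [mul_add, Finset.sum_add_distrib])
    (by intro c v w; simp only [map_smul, PiLp.smul_apply, smul_eq_mul, Finset.mul_sum]
        exact Finset.sum_congr rfl fun i _ => Finset.sum_congr rfl fun j _ => by ring)

/-- The metric at `p`, as a bilinear form on the tangent space. -/
def metricForm (g : Metric n M) (p : M) : LinearMap.BilinForm ℝ (TangentSpace (𝓡 n) p) :=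
  LinearMap.mk₂ ℝ (fun v w => g.inner p v w)
    (by intros; simp) (by intros; simp) (by intros; simp) (by intros; simp)

instance tangentSpace_finiteDimensional (p : M) :
    FiniteDimensional ℝ (TangentSpace (𝓡 n) p) :=
  inferInstanceAs (FiniteDimensional ℝ (EuclideanSpace ℝ (Fin n)))

theorem metricForm_nondegenerate (g : Metric n M) (p : M) : (metricForm g p).Nondegenerate := by
  constructor
  · intro v hv
    by_contra h
    exact (g.pos p v h).ne' (hv v)
  · intro v hv
    by_contra h
    exact (g.pos p v h).ne' (hv v)

/-- Raising an index: the tangent vector `v` with `g(v, ·) = α`. -/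
def sharp (g : Metric n M) (p : M) :
    Module.Dual ℝ (TangentSpace (𝓡 n) p) ≃ₗ[ℝ] TangentSpace (𝓡 n) p :=
  (LinearMap.BilinForm.toDual (metricForm g p) (metricForm_nondegenerate g p)).symm

/-- The Ricci tensor as an endomorphism of the tangent space: `g(Rc v, w) = Rc(v, w)`. Its
eigenvalues and eigenvectors are those of the Ricci tensor. -/
def ricciEnd (g : Metric n M) (p : M) : Module.End ℝ (TangentSpace (𝓡 n) p) :=
  (sharp g p).toLinearMap ∘ₗ ricci g p

/-- The differential `dF` at `p`. -/
def differential (F : M → ℝ) (p : M) : Module.Dual ℝ (TangentSpace (𝓡 n) p) :=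
  (mfderiv (𝓡 n) 𝓘(ℝ, ℝ) F p).toLinearMap

/-- The gradient `∇F` at `p`. -/
def grad (g : Metric n M) (F : M → ℝ) (p : M) : TangentSpace (𝓡 n) p :=
  sharp g p (differential F p)

/-- The unit normal `∇F / |∇F|` of the level surface through `p`. -/
def unitNormal (g : Metric n M) (F : M → ℝ) (p : M) : TangentSpace (𝓡 n) p :=
  (Real.sqrt (g.inner p (grad g F p) (grad g F p)))⁻¹ • grad g F p

/-- `(M, g)` is a gradient steady soliton with potential `F`: the function `F` is smooth, and
`R_{ij} = ∇_i ∇_j F` holds in all smooth local coordinates. -/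
structure IsGradientSteadySoliton (g : Metric n M) (F : M → ℝ) : Prop where
  smooth : ContMDiff (𝓡 n) 𝓘(ℝ, ℝ) ∞ F
  eq : ∀ φ ∈ IsManifold.maximalAtlas (𝓡 n) ∞ M, ∀ x ∈ φ.target, ∀ i j : Fin n,
    ricciCoord (coordMetric g φ) i j x = hessCoord (coordMetric g φ) (F ∘ φ.symm) i j x

/-- `(M, g)` is locally conformally flat: around every point there are smooth local coordinates
in which `g_{ij} = e^{2u} δ_{ij}` for a smooth function `u`. -/
def IsLocallyConformallyFlat (g : Metric n M) : Prop :=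
  ∀ p : M, ∃ φ ∈ IsManifold.maximalAtlas (𝓡 n) ∞ M, p ∈ φ.source ∧
    ∃ u : EuclideanSpace ℝ (Fin n) → ℝ, ContDiffOn ℝ ∞ u φ.target ∧
      ∀ x ∈ φ.target, coordMetric g φ x = Real.exp (2 * u x) • (1 : Matrix (Fin n) (Fin n) ℝ)

/-- `c` is a regular value of `F`: the differential of `F` vanishes nowhere on `{F = c}`. -/
def IsRegularValue (n : ℕ) {M : Type*} [TopologicalSpace M]
    [ChartedSpace (EuclideanSpace ℝ (Fin n)) M] (F : M → ℝ) (c : ℝ) : Prop :=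
  ∀ q : M, F q = c → mfderiv (𝓡 n) 𝓘(ℝ, ℝ) F q ≠ 0

end Manifolds

end SteadySoliton

end

/-! In coordinates with `g = e^{2u} δ`, the Ricci tensor is `-(n-2) B` plus a multiple of `δ`, where
`B = ∂∂u - ∂u ⊗ ∂u`. Put `w = f + (n-2) u`, with `f` the potential in these coordinates. The soliton
equation then expresses every `∂_i ∂_j w` through first derivatives of `u` and `f`, up to a multiple
of `δ_{ij}`. Since `∂_k ∂_i ∂_j w` is symmetric in `k` and `i`, it follows that `B_{jk} f_i - B_{ij}
f_k = δ_{jk} θ_i - δ_{ij} θ_k` for some covector `θ` (`conformal_soliton_tensor`). The explicit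
conformal factor makes this work uniformly in `n ≥ 3`, with no Weyl or Cotton tensor.

For `n ≥ 3` and `∂f ≠ 0`, linear algebra forces `B = a ∂f ⊗ ∂f + b δ` (`eq_rankOne_add_scalar`).
Hence `Rc = A dF ⊗ dF + m g` at `p` (`exists_ricci_eq`), a rank-one perturbation of a scalar: the
normal has eigenvalue `m + A|∇F|²`, and the tangent space of the level set has eigenvalue `m`.

`ricci` is evaluated in the preferred chart, which need not be conformal. Because the soliton
equation holds in every chart, only the Hessian has to be carried from one chart to the other
(`hessCoord_conformal_pullback`); the tensor law for the curvature is never needed. -/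

noncomputable section

namespace SteadySoliton

/-! ### Calculus of partial derivatives. -/

section Calculus

variable {n : ℕ}

theorem pd_congr {f h : EuclideanSpace ℝ (Fin n) → ℝ} {x : EuclideanSpace ℝ (Fin n)}
    (e : f =ᶠ[𝓝 x] h) (i : Fin n) : pd i f x = pd i h x := by
  simp only [pd, e.fderiv_eq]

theorem pd_eventuallyEq {f h : EuclideanSpace ℝ (Fin n) → ℝ} {x : EuclideanSpace ℝ (Fin n)}
    (e : f =ᶠ[𝓝 x] h) (i : Fin n) : pd i f =ᶠ[𝓝 x] pd i h := by
  filter_upwards [e.eventuallyEq_nhds] with y hy using pd_congr hy i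

theorem pd_const (i : Fin n) (c : ℝ) (x : EuclideanSpace ℝ (Fin n)) :
    pd i (fun _ => c) x = 0 := by
  simp [pd]

theorem pd_add {f h : EuclideanSpace ℝ (Fin n) → ℝ} {x : EuclideanSpace ℝ (Fin n)}
    (hf : DifferentiableAt ℝ f x) (hh : DifferentiableAt ℝ h x) (i : Fin n) :
    pd i (fun y => f y + h y) x = pd i f x + pd i h x := by
  simp [pd, fderiv_fun_add hf hh]

theorem pd_sub {f h : EuclideanSpace ℝ (Fin n) → ℝ} {x : EuclideanSpace ℝ (Fin n)}
    (hf : DifferentiableAt ℝ f x) (hh : DifferentiableAt ℝ h x) (i : Fin n) :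
    pd i (fun y => f y - h y) x = pd i f x - pd i h x := by
  simp [pd, fderiv_fun_sub hf hh]

theorem pd_mul {f h : EuclideanSpace ℝ (Fin n) → ℝ} {x : EuclideanSpace ℝ (Fin n)}
    (hf : DifferentiableAt ℝ f x) (hh : DifferentiableAt ℝ h x) (i : Fin n) :
    pd i (fun y => f y * h y) x = pd i f x * h x + f x * pd i h x := by
  simp [pd, fderiv_fun_mul hf hh]
  ring

theorem pd_const_mul {f : EuclideanSpace ℝ (Fin n) → ℝ} {x : EuclideanSpace ℝ (Fin n)}
    (hf : DifferentiableAt ℝ f x) (c : ℝ) (i : Fin n) :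
    pd i (fun y => c * f y) x = c * pd i f x := by
  simp [pd, fderiv_const_mul hf]

theorem pd_sum {ι : Type*} (s : Finset ι) {f : ι → EuclideanSpace ℝ (Fin n) → ℝ}
    {x : EuclideanSpace ℝ (Fin n)} (hf : ∀ a ∈ s, DifferentiableAt ℝ (f a) x) (i : Fin n) :
    pd i (fun y => ∑ a ∈ s, f a y) x = ∑ a ∈ s, pd i (f a) x := by
  simp [pd, fderiv_fun_sum hf]

theorem pd_exp {f : EuclideanSpace ℝ (Fin n) → ℝ} {x : EuclideanSpace ℝ (Fin n)}
    (hf : DifferentiableAt ℝ f x) (i : Fin n) :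
    pd i (fun y => Real.exp (f y)) x = Real.exp (f x) * pd i f x := by
  simp [pd, fderiv_exp hf]

theorem contDiffAt_pd {f : EuclideanSpace ℝ (Fin n) → ℝ} {x : EuclideanSpace ℝ (Fin n)}
    (hf : ContDiffAt ℝ ∞ f x) (i : Fin n) : ContDiffAt ℝ ∞ (pd i f) x :=
  (hf.fderiv_right (m := ∞) (by simp)).clm_apply contDiffAt_const

theorem pd_comm {f : EuclideanSpace ℝ (Fin n) → ℝ} {x : EuclideanSpace ℝ (Fin n)}
    (hf : ContDiffAt ℝ ∞ f x) (i j : Fin n) : pd i (pd j f) x = pd j (pd i f) x := by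
  have hd : DifferentiableAt ℝ (fderiv ℝ f) x :=
    (hf.fderiv_right (m := ∞) (by simp)).differentiableAt (by simp)
  have key (a b : Fin n) : pd a (pd b f) x =
      fderiv ℝ (fderiv ℝ f) x (EuclideanSpace.single a 1) (EuclideanSpace.single b 1) := by
    change fderiv ℝ (fun y => fderiv ℝ f y (EuclideanSpace.single b 1)) x _ = _
    rw [fderiv_clm_apply hd (differentiableAt_const _)]
    simp
  rw [key, key]
  exact (hf.isSymmSndFDerivAt (by simpa using WithTop.coe_le_coe.2 (le_top : (2 : ℕ∞) ≤ ⊤))).eq _ _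

theorem clm_apply_eq_sum (L : EuclideanSpace ℝ (Fin n) →L[ℝ] ℝ) (v : EuclideanSpace ℝ (Fin n)) :
    L v = ∑ a, v a * L (EuclideanSpace.single a 1) := by
  conv_lhs => rw [← (EuclideanSpace.basisFun (Fin n) ℝ).sum_repr v]
  simp

theorem pd_apply {τ : EuclideanSpace ℝ (Fin n) → EuclideanSpace ℝ (Fin n)}
    {x : EuclideanSpace ℝ (Fin n)} (hτ : DifferentiableAt ℝ τ x) (i a : Fin n) :
    pd i (fun y => τ y a) x = fderiv ℝ τ x (EuclideanSpace.single i 1) a := by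
  let P : EuclideanSpace ℝ (Fin n) →L[ℝ] ℝ := EuclideanSpace.proj a
  change fderiv ℝ (P ∘ τ) x _ = _
  rw [(P.hasFDerivAt.comp x hτ.hasFDerivAt).fderiv]
  rfl

theorem pd_comp {h : EuclideanSpace ℝ (Fin n) → ℝ}
    {τ : EuclideanSpace ℝ (Fin n) → EuclideanSpace ℝ (Fin n)} {x : EuclideanSpace ℝ (Fin n)}
    (hh : DifferentiableAt ℝ h (τ x)) (hτ : DifferentiableAt ℝ τ x) (i : Fin n) :
    pd i (fun y => h (τ y)) x = ∑ a, pd a h (τ x) * pd i (fun y => τ y a) x := by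
  have h2 : pd i (fun y => h (τ y)) x =
      fderiv ℝ h (τ x) (fderiv ℝ τ x (EuclideanSpace.single i 1)) := by
    change fderiv ℝ (h ∘ τ) x _ = _
    rw [fderiv_comp x hh hτ]
    rfl
  rw [h2, clm_apply_eq_sum]
  exact Finset.sum_congr rfl fun a _ => by rw [pd_apply hτ, mul_comm]; rfl

end Calculus

/-! ### Curvature of a conformally flat metric. -/

section ConformallyFlat

variable {n : ℕ} {G : EuclideanSpace ℝ (Fin n) → Matrix (Fin n) (Fin n) ℝ}
  {u : EuclideanSpace ℝ (Fin n) → ℝ} {x : EuclideanSpace ℝ (Fin n)}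

theorem christoffel_conformal (hu : DifferentiableAt ℝ u x)
    (hG : G =ᶠ[𝓝 x] fun y => Real.exp (2 * u y) • (1 : Matrix (Fin n) (Fin n) ℝ))
    (k i j : Fin n) :
    christoffel G k i j x = (if k = j then pd i u x else 0) + (if k = i then pd j u x else 0)
      - (if i = j then pd k u x else 0) := by
  have hpd (a b d : Fin n) : pd a (fun y => G y b d) x =
      if b = d then 2 * Real.exp (2 * u x) * pd a u x else 0 := by
    have e : (fun y => G y b d) =ᶠ[𝓝 x]
        fun y => (1 : Matrix (Fin n) (Fin n) ℝ) b d * Real.exp (2 * u y) := by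
      filter_upwards [hG] with y hy
      rw [hy, Matrix.smul_apply, smul_eq_mul, mul_comm]
    have h2 : DifferentiableAt ℝ (fun y => 2 * u y) x := hu.const_mul 2
    rw [pd_congr e, pd_const_mul h2.exp, pd_exp h2, pd_const_mul hu, Matrix.one_apply]
    split_ifs <;> ring
  have hinv : (G x)⁻¹ = (Real.exp (2 * u x))⁻¹ • (1 : Matrix (Fin n) (Fin n) ℝ) := by
    rw [hG.eq_of_nhds]
    refine Matrix.inv_eq_right_inv ?_
    rw [smul_mul_smul_comm, mul_inv_cancel₀ (Real.exp_ne_zero _), one_smul, one_mul]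
  have h0 := Real.exp_ne_zero (2 * u x)
  simp only [christoffel, hpd, hinv, Matrix.smul_apply, Matrix.one_apply, smul_eq_mul, mul_ite,
    mul_one, mul_zero, ite_mul, zero_mul, Finset.sum_ite_eq, Finset.mem_univ, if_true]
  simp only [@eq_comm _ k j, @eq_comm _ k i]
  split_ifs <;> field_simp <;> ring

theorem pd_christoffel_conformal (hu : ContDiffAt ℝ ∞ u x)
    (hG : G =ᶠ[𝓝 x] fun y => Real.exp (2 * u y) • (1 : Matrix (Fin n) (Fin n) ℝ))
    (l k i j : Fin n) :
    pd l (christoffel G k i j) x =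
      (if k = j then pd l (pd i u) x else 0) + (if k = i then pd l (pd j u) x else 0)
      - (if i = j then pd l (pd k u) x else 0) := by
  have hd (a : Fin n) : DifferentiableAt ℝ (pd a u) x :=
    (contDiffAt_pd hu a).differentiableAt (by simp)
  have hdi (P : Prop) [Decidable P] (a : Fin n) :
      DifferentiableAt ℝ (fun y => if P then pd a u y else 0) x := by
    split_ifs
    · exact hd a
    · exact differentiableAt_const 0
  have hpi (P : Prop) [Decidable P] (a : Fin n) :
      pd l (fun y => if P then pd a u y else 0) x = if P then pd l (pd a u) x else 0 := by
    split_ifs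
    · rfl
    · exact pd_const l 0 x
  have e : christoffel G k i j =ᶠ[𝓝 x] fun y => (if k = j then pd i u y else 0)
      + (if k = i then pd j u y else 0) - (if i = j then pd k u y else 0) := by
    -- `ContDiffAt ℝ ∞` at a point gives a neighbourhood for each finite order, not one for all
    -- orders; order one is enough here.
    have hu1 : ∀ᶠ y in 𝓝 x, ContDiffAt ℝ 1 u y :=
      (hu.of_le (WithTop.coe_le_coe.2 (le_top : (1 : ℕ∞) ≤ ⊤))).eventually (by simp)
    filter_upwards [hG.eventuallyEq_nhds, hu1] with y hy hy'
    exact christoffel_conformal (hy'.differentiableAt (by simp)) hy k i j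
  rw [pd_congr e, pd_sub ((hdi _ _).fun_add (hdi _ _)) (hdi _ _), pd_add (hdi _ _) (hdi _ _),
    hpi, hpi, hpi]

/-- The classical conformal change formula over a flat background. Later only the tensor multiplied
by `-(n-2)` matters; the `δ` term is carried along as an unspecified function. -/
theorem ricciCoord_conformal (hu : ContDiffAt ℝ ∞ u x)
    (hG : G =ᶠ[𝓝 x] fun y => Real.exp (2 * u y) • (1 : Matrix (Fin n) (Fin n) ℝ))
    (j k : Fin n) :
    ricciCoord G j k x = -((n : ℝ) - 2) * (pd j (pd k u) x - pd j u x * pd k u x)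
      - (if j = k then ∑ i, pd i (pd i u) x + ((n : ℝ) - 2) * ∑ i, pd i u x * pd i u x else 0) := by
  have hd : DifferentiableAt ℝ u x := hu.differentiableAt (by simp)
  have hR (i : Fin n) : riemannCoord G i j k i x =
      ((if i = k then pd i (pd j u) x else 0) + (if i = j then pd i (pd k u) x else 0)
      - (if j = k then pd i (pd i u) x else 0)) - pd j (pd k u) x
      + ((pd k u x * pd j u x - if j = k then ∑ m, pd m u x * pd m u x else 0)
        - (if i = j then 2 * pd i u x * pd k u x
            - (if i = k then ∑ m, pd m u x * pd m u x else 0) - pd i u x * pd k u x else 0)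
        + (if j = k then pd i u x * pd i u x else 0)
        - (if i = k then pd i u x * pd j u x else 0)) := by
    have h1 : ∑ m, christoffel G i i m x * christoffel G m j k x =
        2 * (pd k u x * pd j u x) - if j = k then ∑ m, pd m u x * pd m u x else 0 := by
      -- Here `i` is fixed: the factor `n` of the full trace appears only when `hR` is summed over
      -- `i`.
      have hc (m : Fin n) : christoffel G i i m x = pd m u x := by
        rw [christoffel_conformal hd hG]
        simp
      simp only [hc, christoffel_conformal hd hG, mul_add, mul_sub, Finset.sum_add_distrib,
        Finset.sum_sub_distrib, mul_ite, mul_zero, Finset.sum_ite_eq', Finset.mem_univ, if_true]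
      split_ifs <;> simp <;> ring
    have h2 : ∑ m, christoffel G i j m x * christoffel G m i k x =
        pd j u x * pd k u x + (if i = j then 2 * pd i u x * pd k u x
            - (if i = k then ∑ m, pd m u x * pd m u x else 0) else 0)
        - ((if j = k then pd i u x * pd i u x else 0) + (if i = j then pd i u x * pd k u x else 0)
          - (if i = k then pd i u x * pd j u x else 0)) := by
      simp only [christoffel_conformal hd hG, sub_mul, add_mul, ite_mul, zero_mul,
        Finset.sum_add_distrib, Finset.sum_sub_distrib, Finset.sum_ite_eq, Finset.mem_univ, if_true]
      by_cases h : i = j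
      · subst h
        simp only [if_true, mul_add, mul_sub, Finset.sum_add_distrib,
          Finset.sum_sub_distrib, mul_ite, mul_zero, Finset.sum_ite_eq', Finset.mem_univ]
        split_ifs <;> simp <;> ring
      · simp only [h, Ne.symm h, eq_comm, if_false, Finset.sum_const_zero]
        split_ifs <;> simp <;> ring
    simp only [riemannCoord, pd_christoffel_conformal hu hG, Finset.sum_sub_distrib, h1, h2]
    simp only [if_true]
    split_ifs <;> ring
  simp only [ricciCoord, hR]
  simp only [Finset.sum_add_distrib, Finset.sum_sub_distrib, Finset.sum_ite_eq',
    Finset.mem_univ, if_true, Finset.sum_const, Finset.card_univ, Fintype.card_fin, nsmul_eq_mul]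
  rw [pd_comm hu k j]
  by_cases h : j = k
  · subst h
    simp
    ring
  · simp [h]
    ring

end ConformallyFlat

/-! ### The Hessian under a change of coordinates. -/

section Hessian

variable {n : ℕ}

/-- The Hessian of `f` with respect to the conformally flat metric `e^{2u} δ`. -/
def conformalHess (u f : EuclideanSpace ℝ (Fin n) → ℝ) (a b : Fin n)
    (x : EuclideanSpace ℝ (Fin n)) : ℝ :=
  pd a (pd b f) x - pd a u x * pd b f x - pd b u x * pd a f x
    + if a = b then ∑ d, pd d u x * pd d f x else 0

theorem pd_pd_comp {f : EuclideanSpace ℝ (Fin n) → ℝ}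
    {τ : EuclideanSpace ℝ (Fin n) → EuclideanSpace ℝ (Fin n)} {x : EuclideanSpace ℝ (Fin n)}
    (hτ : ContDiffAt ℝ ∞ τ x) (hf : ContDiffAt ℝ ∞ f (τ x)) (i j : Fin n) :
    pd i (pd j fun y => f (τ y)) x =
      (∑ a, ∑ b, pd a (pd b f) (τ x) * pd i (fun y => τ y a) x * pd j (fun y => τ y b) x)
        + ∑ b, pd b f (τ x) * pd i (pd j fun y => τ y b) x := by
  have hτa (a : Fin n) : ContDiffAt ℝ ∞ (fun y => τ y a) x := by
    exact (contDiffAt_piLp 2).1 hτ a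
  have hdτ : DifferentiableAt ℝ τ x := hτ.differentiableAt (by simp)
  have hτ1 : ∀ᶠ y in 𝓝 x, ContDiffAt ℝ 1 τ y :=
    (hτ.of_le (WithTop.coe_le_coe.2 (le_top : (1 : ℕ∞) ≤ ⊤))).eventually (by simp)
  have hf1 : ∀ᶠ y in 𝓝 x, ContDiffAt ℝ 1 f (τ y) :=
    hτ.continuousAt.eventually
      ((hf.of_le (WithTop.coe_le_coe.2 (le_top : (1 : ℕ∞) ≤ ⊤))).eventually (by simp))
  have e : pd j (fun y => f (τ y)) =ᶠ[𝓝 x]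
      fun y => ∑ b, pd b f (τ y) * pd j (fun z => τ z b) y := by
    filter_upwards [hτ1, hf1] with y h1 h2
    exact pd_comp (h2.differentiableAt (by simp)) (h1.differentiableAt (by simp)) j
  have hdf (b : Fin n) : DifferentiableAt ℝ (pd b f) (τ x) :=
    (contDiffAt_pd hf b).differentiableAt (by simp)
  have hdf' (b : Fin n) : DifferentiableAt ℝ (fun y => pd b f (τ y)) x := (hdf b).comp x hdτ
  have hdj (b : Fin n) : DifferentiableAt ℝ (pd j fun y => τ y b) x :=
    (contDiffAt_pd (hτa b) j).differentiableAt (by simp)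
  rw [pd_congr e, pd_sum _ fun b _ => (hdf' b).fun_mul (hdj b), Finset.sum_comm,
    ← Finset.sum_add_distrib]
  refine Finset.sum_congr rfl fun b _ => ?_
  rw [pd_mul (hdf' b) (hdj b), pd_comp (hdf b) hdτ, Finset.sum_mul]

/-- The Hessian is a tensor: the term `∂f · ∂∂τ` produced by the second-order chain rule is
cancelled by the `∂∂τ` part of the Christoffel symbols of the pulled-back metric. -/
theorem hessCoord_conformal_pullback {G : EuclideanSpace ℝ (Fin n) → Matrix (Fin n) (Fin n) ℝ}
    {u f h : EuclideanSpace ℝ (Fin n) → ℝ}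
    {τ : EuclideanSpace ℝ (Fin n) → EuclideanSpace ℝ (Fin n)} {x : EuclideanSpace ℝ (Fin n)}
    (hτ : ContDiffAt ℝ ∞ τ x) (hu : ContDiffAt ℝ ∞ u (τ x)) (hf : ContDiffAt ℝ ∞ f (τ x))
    (hh : h =ᶠ[𝓝 x] fun y => f (τ y))
    (hG : ∀ i j, (fun y => G y i j) =ᶠ[𝓝 x] fun y => Real.exp (2 * u (τ y))
      * ∑ a, pd i (fun z => τ z a) y * pd j (fun z => τ z a) y)
    (hJ : IsUnit (Matrix.of fun a i => pd i (fun z => τ z a) x).det) (i j : Fin n) :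
    hessCoord G h i j x = ∑ a, ∑ b, conformalHess u f a b (τ x)
      * pd i (fun z => τ z a) x * pd j (fun z => τ z b) x := by
  set J : Matrix (Fin n) (Fin n) ℝ := Matrix.of fun a i => pd i (fun z => τ z a) x with hJdef
  have hJa (a i : Fin n) : pd i (fun z => τ z a) x = J a i := rfl
  set E := Real.exp (2 * u (τ x)) with hE
  have hE0 : E ≠ 0 := Real.exp_ne_zero _
  have hdτ : DifferentiableAt ℝ τ x := hτ.differentiableAt (by simp)
  have hdu : DifferentiableAt ℝ u (τ x) := hu.differentiableAt (by simp)
  have hdf : DifferentiableAt ℝ f (τ x) := hf.differentiableAt (by simp)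
  have hτa (a : Fin n) : ContDiffAt ℝ ∞ (fun y => τ y a) x := (contDiffAt_piLp 2).1 hτ a
  have hdj (a j : Fin n) : DifferentiableAt ℝ (pd j fun y => τ y a) x :=
    (contDiffAt_pd (hτa a) j).differentiableAt (by simp)
  have hh1 (k : Fin n) : pd k h x = ∑ a, pd a f (τ x) * J a k := by
    rw [pd_congr hh, pd_comp hdf hdτ]; rfl
  have hv1 (k : Fin n) : pd k (fun y => u (τ y)) x = ∑ a, pd a u (τ x) * J a k := by
    rw [pd_comp hdu hdτ]; rfl
  have hGx : G x = E • (J.transpose * J) := by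
    ext k l
    have := (hG k l).eq_of_nhds
    simp only at this
    rw [this]
    simp [Matrix.mul_apply, J, hE]
  have hGinv : (G x)⁻¹ = E⁻¹ • (J⁻¹ * J⁻¹.transpose) := by
    refine Matrix.inv_eq_right_inv ?_
    rw [hGx, smul_mul_smul_comm, mul_inv_cancel₀ hE0, one_smul, Matrix.mul_assoc,
      Matrix.mul_nonsing_inv_cancel_left _ _ hJ, ← Matrix.transpose_mul,
      Matrix.nonsing_inv_mul _ hJ, Matrix.transpose_one]
  -- `X` is the gradient of `h` for `G`. Its image under `J` is the gradient of `f` for `e^{2u} δ`,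
  -- so after `hXJ` no inverse matrix remains.
  set X : Fin n → ℝ := fun l => ∑ k, (G x)⁻¹ k l * pd k h x with hX
  have hXJ (b : Fin n) : ∑ l, X l * J b l = E⁻¹ * pd b f (τ x) := by
    have e1 : (fun k => pd k h x) = Matrix.vecMul (fun a => pd a f (τ x)) J := by
      ext k; rw [hh1]; rfl
    have e2 : X = Matrix.vecMul (fun k => pd k h x) (G x)⁻¹ := by
      ext l
      simp only [hX, Matrix.vecMul, dotProduct]
      exact Finset.sum_congr rfl fun k _ => mul_comm _ _
    have e3 : Matrix.vecMul X J.transpose = E⁻¹ • fun a => pd a f (τ x) := by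
      rw [e2, e1, hGinv, Matrix.vecMul_vecMul, Matrix.vecMul_vecMul, Matrix.smul_mul,
        Matrix.mul_smul, Matrix.mul_assoc, Matrix.mul_nonsing_inv_cancel_left _ _ hJ, ← Matrix.transpose_mul,
        Matrix.mul_nonsing_inv _ hJ, Matrix.transpose_one, Matrix.vecMul_smul, Matrix.vecMul_one]
    exact congrFun e3 b
  have hpd (k i j : Fin n) : pd k (fun y => G y i j) x =
      E * (2 * pd k (fun y => u (τ y)) x * ∑ a, J a i * J a j
        + ∑ a, (pd k (pd i fun z => τ z a) x * J a j + J a i * pd k (pd j fun z => τ z a) x)) := by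
    have hd1 : DifferentiableAt ℝ (fun y => u (τ y)) x := hdu.comp x hdτ
    have hd2 : DifferentiableAt ℝ (fun y => 2 * u (τ y)) x := hd1.const_mul 2
    have hd3 : ∀ a ∈ Finset.univ, DifferentiableAt ℝ
        (fun y => pd i (fun z => τ z a) y * pd j (fun z => τ z a) y) x :=
      fun a _ => (hdj a i).mul (hdj a j)
    rw [pd_congr (hG i j), pd_mul hd2.exp (DifferentiableAt.fun_sum hd3), pd_exp hd2,
      pd_const_mul hd1, pd_sum _ hd3]
    simp only [pd_mul (hdj _ i) (hdj _ j), hJa]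
    ring
  -- By symmetry of second derivatives, of the six terms in `∂∂τ` only two equal ones, `∂_i ∂_j τ ·
  -- ∂_l τ`, survive.
  have hbr (l : Fin n) : pd i (fun y => G y j l) x + pd j (fun y => G y i l) x
      - pd l (fun y => G y i j) x = 2 * E * (pd i (fun y => u (τ y)) x * ∑ a, J a j * J a l
        + pd j (fun y => u (τ y)) x * ∑ a, J a i * J a l
        - (∑ a, pd a u (τ x) * J a l) * ∑ a, J a i * J a j
        + ∑ a, pd i (pd j fun z => τ z a) x * J a l) := by
    rw [hpd, hpd, hpd, ← hv1 l]
    simp only [pd_comm (hτa _) j i, pd_comm (hτa _) l i, pd_comm (hτa _) l j,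
      Finset.sum_add_distrib]
    simp only [mul_comm (pd i (pd l _) x)]
    ring
  have hcontr (w : Fin n → ℝ) : ∑ l, X l * ∑ a, w a * J a l =
      E⁻¹ * ∑ a, w a * pd a f (τ x) := by
    simp only [Finset.mul_sum]
    rw [Finset.sum_comm]
    refine Finset.sum_congr rfl fun a _ => ?_
    rw [mul_left_comm, ← hXJ, Finset.mul_sum]
    exact Finset.sum_congr rfl fun l _ => by ring
  have hΓ : ∑ k, christoffel G k i j x * pd k h x =
      pd i (fun y => u (τ y)) x * ∑ a, J a j * pd a f (τ x)
        + pd j (fun y => u (τ y)) x * ∑ a, J a i * pd a f (τ x)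
        - (∑ a, pd a u (τ x) * pd a f (τ x)) * ∑ a, J a i * J a j
        + ∑ a, pd i (pd j fun z => τ z a) x * pd a f (τ x) := by
    have e1 : ∑ k, christoffel G k i j x * pd k h x =
        E * ∑ l, X l * (pd i (fun y => u (τ y)) x * ∑ a, J a j * J a l
        + pd j (fun y => u (τ y)) x * ∑ a, J a i * J a l
        - (∑ a, pd a u (τ x) * J a l) * ∑ a, J a i * J a j
        + ∑ a, pd i (pd j fun z => τ z a) x * J a l) := by
      have swap (b : Fin n → ℝ) :
          ∑ k, (1 / 2 * ∑ l, (G x)⁻¹ k l * (2 * E * b l)) * pd k h x = E * ∑ l, X l * b l := by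
        simp only [hX, Finset.mul_sum, Finset.sum_mul]
        rw [Finset.sum_comm]
        exact Finset.sum_congr rfl fun l _ => Finset.sum_congr rfl fun k _ => by ring
      simp only [christoffel, hbr]
      exact swap _
    have e2 (l : Fin n) : X l * (pd i (fun y => u (τ y)) x * ∑ a, J a j * J a l
        + pd j (fun y => u (τ y)) x * ∑ a, J a i * J a l
        - (∑ a, pd a u (τ x) * J a l) * ∑ a, J a i * J a j
        + ∑ a, pd i (pd j fun z => τ z a) x * J a l) =
        pd i (fun y => u (τ y)) x * (X l * ∑ a, J a j * J a l)
        + pd j (fun y => u (τ y)) x * (X l * ∑ a, J a i * J a l)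
        - (∑ a, J a i * J a j) * (X l * ∑ a, pd a u (τ x) * J a l)
        + X l * ∑ a, pd i (pd j fun z => τ z a) x * J a l := by ring
    rw [e1]
    simp only [e2, Finset.sum_add_distrib, Finset.sum_sub_distrib]
    simp only [← Finset.mul_sum, hcontr]
    field_simp
  rw [hessCoord, hΓ, pd_congr (pd_eventuallyEq hh j), pd_pd_comp hτ hf, hv1, hv1]
  simp only [hJa, conformalHess]
  simp only [add_mul, sub_mul, Finset.sum_add_distrib, Finset.sum_sub_distrib, ite_mul, zero_mul,
    Finset.sum_ite_eq, Finset.mem_univ, if_true]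
  have e1 : ∑ a, ∑ b, pd a u (τ x) * pd b f (τ x) * J a i * J b j =
      (∑ a, pd a u (τ x) * J a i) * ∑ b, J b j * pd b f (τ x) := by
    simp only [Finset.sum_mul, Finset.mul_sum]
    rw [Finset.sum_comm]
    exact Finset.sum_congr rfl fun a _ => Finset.sum_congr rfl fun b _ => by ring
  have e2 : ∑ a, ∑ b, pd b u (τ x) * pd a f (τ x) * J a i * J b j =
      (∑ b, pd b u (τ x) * J b j) * ∑ a, J a i * pd a f (τ x) := by
    simp only [Finset.sum_mul, Finset.mul_sum]
    exact Finset.sum_congr rfl fun a _ => Finset.sum_congr rfl fun b _ => by ring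
  have e3 : ∑ a, (∑ d, pd d u (τ x) * pd d f (τ x)) * J a i * J a j =
      (∑ d, pd d u (τ x) * pd d f (τ x)) * ∑ a, J a i * J a j := by
    rw [Finset.mul_sum]
    exact Finset.sum_congr rfl fun a _ => mul_assoc _ _ _
  have e4 : ∑ a, pd i (pd j fun z => τ z a) x * pd a f (τ x) =
      ∑ a, pd a f (τ x) * pd i (pd j fun z => τ z a) x :=
    Finset.sum_congr rfl fun a _ => mul_comm _ _
  rw [e1, e2, e3, e4]
  ring

end Hessian

/-! ### Linear algebra of the integrability identity. -/

section Algebra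

/-- Contracting `h` with `f` writes `B` in terms of `f`, `θ`, `β = B f` and `δ`; symmetry of `B`
then makes `β + θ` parallel to `f`. The trace of `h` gives `t f - (β + θ) = (n-2) θ`, so for `n ≥ 3`
both `θ` and `β` are parallel to `f`. -/
theorem eq_rankOne_add_scalar {n : ℕ} (hn : 3 ≤ n) {B : Fin n → Fin n → ℝ} {f θ : Fin n → ℝ}
    (hB : ∀ j k, B j k = B k j) (hf : f ≠ 0)
    (h : ∀ i j k, B j k * f i - B i j * f k
      = (if j = k then θ i else 0) - (if i = j then θ k else 0)) :
    ∃ a b : ℝ, ∀ j k, B j k = a * (f j * f k) + if j = k then b else 0 := by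
  set S := ∑ i, f i * f i with hS
  have hS0 : S ≠ 0 := by
    intro h0
    rw [Finset.sum_eq_zero_iff_of_nonneg fun i _ => mul_self_nonneg _] at h0
    exact hf (funext fun i => mul_self_eq_zero.1 (h0 i (Finset.mem_univ i)))
  set β : Fin n → ℝ := fun j => ∑ i, B i j * f i with hβ
  set T := ∑ i, θ i * f i with hT
  have h1 (j k : Fin n) : S * B j k - β j * f k = (if j = k then T else 0) - θ k * f j := by
    have := Finset.sum_congr (rfl : (Finset.univ : Finset (Fin n)) = _)
      fun i _ => congrArg (· * f i) (h i j k)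
    simp only [sub_mul, Finset.sum_sub_distrib, ite_mul, zero_mul, Finset.sum_ite_eq',
      Finset.mem_univ, if_true] at this
    have e1 : ∑ i, B j k * f i * f i = S * B j k := by
      rw [hS, Finset.sum_mul]; exact Finset.sum_congr rfl fun i _ => by ring
    have e2 : ∑ i, B i j * f k * f i = β j * f k := by
      rw [hβ, Finset.sum_mul]; exact Finset.sum_congr rfl fun i _ => by ring
    have e3 : (∑ i, if j = k then θ i * f i else 0) = if j = k then T else 0 := by
      split_ifs <;> simp [hT]
    rw [e1, e2, e3] at this
    exact this
  set t := ∑ j, B j j with ht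
  have h2 (i : Fin n) : t * f i - β i = ((n : ℝ) - 1) * θ i := by
    have := Finset.sum_congr (rfl : (Finset.univ : Finset (Fin n)) = _)
      fun j _ => h i j j
    simp only [Finset.sum_sub_distrib, Finset.sum_ite_eq, Finset.mem_univ, if_true,
      Finset.sum_const, Finset.card_univ, Fintype.card_fin, nsmul_eq_mul, ← Finset.sum_mul] at this
    have e : ∑ j, B i j * f j = β i := Finset.sum_congr rfl fun j _ => by rw [hB]
    rw [e] at this
    linarith
  set c := ∑ k, (β k + θ k) * f k with hc
  have h3 (j : Fin n) : S * (β j + θ j) = c * f j := by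
    have e (k : Fin n) : (β j + θ j) * f k = (β k + θ k) * f j := by
      have a := h1 j k
      have b := h1 k j
      rw [hB k j, if_congr (eq_comm (a := k)) rfl rfl] at b
      linarith
    rw [hS, hc, Finset.sum_mul, Finset.sum_mul]
    exact Finset.sum_congr rfl fun k _ => by linear_combination f k * e k
  have hn2 : (n : ℝ) - 2 ≠ 0 := by
    have : (3 : ℝ) ≤ n := by exact_mod_cast hn
    linarith
  -- Solves `S t f - c f = (n-2) S θ`, which combines `h2` and `h3`.
  set r := (S * t - c) / (((n : ℝ) - 2) * S) with hr
  have h4 (j : Fin n) : θ j = r * f j := by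
    rw [hr, div_mul_eq_mul_div, eq_div_iff (mul_ne_zero hn2 hS0)]
    linear_combination (-S) * h2 j - h3 j
  set q := t - ((n : ℝ) - 1) * r with hq
  have h5 (j : Fin n) : β j = q * f j := by
    have := h2 j
    rw [h4] at this
    rw [hq]; linarith
  refine ⟨(q - r) / S, T / S, fun j k => ?_⟩
  have := h1 j k
  rw [h5, h4] at this
  split_ifs at this ⊢ <;> field_simp <;> linarith

end Algebra

/-! ### The integrability condition of the soliton equation. -/

section Soliton

variable {n : ℕ}

theorem hessCoord_conformal {G : EuclideanSpace ℝ (Fin n) → Matrix (Fin n) (Fin n) ℝ}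
    {u : EuclideanSpace ℝ (Fin n) → ℝ} {x : EuclideanSpace ℝ (Fin n)}
    (hu : DifferentiableAt ℝ u x)
    (hG : G =ᶠ[𝓝 x] fun y => Real.exp (2 * u y) • (1 : Matrix (Fin n) (Fin n) ℝ))
    (f : EuclideanSpace ℝ (Fin n) → ℝ) (i j : Fin n) :
    hessCoord G f i j x = conformalHess u f i j x := by
  simp only [hessCoord, conformalHess, christoffel_conformal hu hG, sub_mul, add_mul, ite_mul,
    zero_mul, Finset.sum_add_distrib, Finset.sum_sub_distrib, Finset.sum_ite_eq', Finset.mem_univ,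
    if_true]
  split_ifs
  · ring
  · rw [Finset.sum_const_zero]
    ring

/-- Commuting third derivatives of `w = f + c u` removes all third derivatives except those hidden
in `∂ψ`, which only enter `θ`. Replacing the Hessian of `f` by means of the equation then cancels
every term containing `c`. -/
theorem conformal_soliton_tensor {c : ℝ} {u f ρ : EuclideanSpace ℝ (Fin n) → ℝ}
    {x : EuclideanSpace ℝ (Fin n)}
    (hu : ContDiffAt ℝ ∞ u x) (hf : ContDiffAt ℝ ∞ f x) (hρ : DifferentiableAt ℝ ρ x)
    (h : ∀ᶠ y in 𝓝 x, ∀ i j, -c * (pd i (pd j u) y - pd i u y * pd j u y)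
      - (if i = j then ρ y else 0) = conformalHess u f i j y) :
    ∃ θ : Fin n → ℝ, ∀ i j k, (pd j (pd k u) x - pd j u x * pd k u x) * pd i f x
      - (pd i (pd j u) x - pd i u x * pd j u x) * pd k f x
      = (if j = k then θ i else 0) - (if i = j then θ k else 0) := by
  have hdu (a : Fin n) : DifferentiableAt ℝ (pd a u) x :=
    (contDiffAt_pd hu a).differentiableAt (by simp)
  have hdf (a : Fin n) : DifferentiableAt ℝ (pd a f) x :=
    (contDiffAt_pd hf a).differentiableAt (by simp)
  set ψ : EuclideanSpace ℝ (Fin n) → ℝ := fun y => -1 * ρ y - ∑ d, pd d u y * pd d f y with hψ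
  have hdψ : DifferentiableAt ℝ ψ x :=
    (hρ.const_mul (-1)).sub (DifferentiableAt.fun_sum fun d _ => (hdu d).mul (hdf d))
  set w : EuclideanSpace ℝ (Fin n) → ℝ := fun y => f y + c * u y with hw
  have hsw : ContDiffAt ℝ ∞ w x := hf.add (contDiffAt_const.mul hu)
  -- The Kronecker delta is kept as a constant factor of `ψ`, so that it passes through
  -- `pd_const_mul`.
  have hww (i j : Fin n) : pd i (pd j w) =ᶠ[𝓝 x] fun y => pd i u y * pd j f y
      + pd j u y * pd i f y + c * (pd i u y * pd j u y) + (if i = j then 1 else 0) * ψ y := by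
    have hev (g : EuclideanSpace ℝ (Fin n) → ℝ) (hg : ContDiffAt ℝ ∞ g x) :
        ∀ᶠ y in 𝓝 x, DifferentiableAt ℝ g y :=
      ((hg.of_le (WithTop.coe_le_coe.2 (le_top : (1 : ℕ∞) ≤ ⊤))).eventually (by simp)).mono
        fun y hy => hy.differentiableAt (by simp)
    have e1 : pd j w =ᶠ[𝓝 x] fun y => pd j f y + c * pd j u y := by
      filter_upwards [hev f hf, hev u hu] with y h1 h2
      rw [pd_add h1 (h2.const_mul c), pd_const_mul h2]
    filter_upwards [h, hev _ (contDiffAt_pd hf j), hev _ (contDiffAt_pd hu j),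
      pd_eventuallyEq e1 i] with y hy h1 h2 h3
    have := hy i j
    rw [h3, pd_add h1 (h2.const_mul c), pd_const_mul h2]
    simp only [conformalHess] at this
    simp only [hψ]
    split_ifs at this ⊢ <;> linarith
  have hwww (k i j : Fin n) : pd k (pd i (pd j w)) x =
      pd k (pd i u) x * pd j f x + pd i u x * pd k (pd j f) x
      + (pd k (pd j u) x * pd i f x + pd j u x * pd k (pd i f) x)
      + c * (pd k (pd i u) x * pd j u x + pd i u x * pd k (pd j u) x)
      + (if i = j then 1 else 0) * pd k ψ x := by
    rw [pd_congr (hww i j), pd_add, pd_add, pd_add, pd_const_mul, pd_const_mul, pd_mul, pd_mul,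
      pd_mul]
    all_goals first | exact hdu _ | exact hdf _ | exact hdψ | skip
    · exact (hdu _).mul (hdu _)
    · exact (hdu _).mul (hdf _)
    · exact (hdu _).mul (hdf _)
    · exact ((hdu _).mul (hdf _)).add ((hdu _).mul (hdf _))
    · exact ((hdu _).mul (hdu _)).const_mul c
    · exact (((hdu _).mul (hdf _)).add ((hdu _).mul (hdf _))).add
        (((hdu _).mul (hdu _)).const_mul c)
    · exact hdψ.const_mul _
  have hhess (i j : Fin n) : pd i (pd j f) x = pd i u x * pd j f x
      + pd j u x * pd i f x + c * (pd i u x * pd j u x) + (if i = j then 1 else 0) * ψ x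
      - c * pd i (pd j u) x := by
    have := h.self_of_nhds i j
    simp only [conformalHess] at this
    simp only [hψ]
    split_ifs at this ⊢ <;> linarith
  refine ⟨fun i => pd i ψ x - ψ x * pd i u x, fun i j k => ?_⟩
  have key := pd_comm (contDiffAt_pd hsw j) i k
  rw [hwww, hwww] at key
  simp only [hhess] at key
  rw [pd_comm hu k i, pd_comm hu k j] at key
  simp only [@eq_comm _ k j, @eq_comm _ k i] at key
  split_ifs at key ⊢ <;> linear_combination -key

end Soliton

/-! ### Change of charts for differentials, vectors and the metric. -/

section Charts

variable {n : ℕ} {M : Type*} [TopologicalSpace M] [ChartedSpace (EuclideanSpace ℝ (Fin n)) M]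

theorem contMDiffAt_chart {φ : OpenPartialHomeomorph M (EuclideanSpace ℝ (Fin n))}
    (hφ : φ ∈ IsManifold.maximalAtlas (𝓡 n) ∞ M) {p : M} (hp : p ∈ φ.source) :
    ContMDiffAt (𝓡 n) (𝓡 n) ∞ φ p :=
  (contMDiffOn_of_mem_maximalAtlas hφ).contMDiffAt (φ.open_source.mem_nhds hp)

theorem contMDiffAt_chart_symm {φ : OpenPartialHomeomorph M (EuclideanSpace ℝ (Fin n))}
    (hφ : φ ∈ IsManifold.maximalAtlas (𝓡 n) ∞ M) {x : EuclideanSpace ℝ (Fin n)}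
    (hx : x ∈ φ.target) : ContMDiffAt (𝓡 n) (𝓡 n) ∞ φ.symm x :=
  (contMDiffOn_symm_of_mem_maximalAtlas hφ).contMDiffAt (φ.open_target.mem_nhds hx)

theorem contDiffAt_transition {φ ψ : OpenPartialHomeomorph M (EuclideanSpace ℝ (Fin n))}
    (hφ : φ ∈ IsManifold.maximalAtlas (𝓡 n) ∞ M) (hψ : ψ ∈ IsManifold.maximalAtlas (𝓡 n) ∞ M)
    {x : EuclideanSpace ℝ (Fin n)} (hx : x ∈ ψ.target) (hx' : ψ.symm x ∈ φ.source) :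
    ContDiffAt ℝ ∞ (fun y => φ (ψ.symm y)) x :=
  ((contMDiffAt_chart hφ hx').comp x (contMDiffAt_chart_symm hψ hx)).contDiffAt

theorem differential_eq_fderiv {φ : OpenPartialHomeomorph M (EuclideanSpace ℝ (Fin n))}
    (hφ : φ ∈ IsManifold.maximalAtlas (𝓡 n) ∞ M) {F : M → ℝ}
    (hF : ContMDiff (𝓡 n) 𝓘(ℝ, ℝ) ∞ F) {p : M} (hp : p ∈ φ.source) (v : TangentSpace (𝓡 n) p) :
    differential F p v = ∑ a, coords φ p v a * pd a (F ∘ φ.symm) (φ p) := by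
  have e : F =ᶠ[𝓝 p] (F ∘ φ.symm) ∘ φ := by
    filter_upwards [φ.open_source.mem_nhds hp] with q hq
    simp [φ.left_inv hq]
  have hf : ContMDiffAt (𝓡 n) 𝓘(ℝ, ℝ) ∞ (F ∘ φ.symm) (φ p) :=
    hF.contMDiffAt.comp _ (contMDiffAt_chart_symm hφ (φ.map_source hp))
  have h := congrArg (fun L : EuclideanSpace ℝ (Fin n) →L[ℝ] ℝ => L v)
    (mfderiv_comp p (hf.mdifferentiableAt (by simp))
      ((contMDiffAt_chart hφ hp).mdifferentiableAt (by simp)))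
  refine Eq.trans ?_ (clm_apply_eq_sum (fderiv ℝ (F ∘ φ.symm) (φ p)) (coords φ p v))
  rw [← mfderiv_eq_fderiv]
  change (mfderiv (𝓡 n) 𝓘(ℝ, ℝ) F p v : ℝ) = _
  rw [e.mfderiv_eq]
  exact h

theorem mfderiv_symm_eq {φ ψ : OpenPartialHomeomorph M (EuclideanSpace ℝ (Fin n))}
    (hφ : φ ∈ IsManifold.maximalAtlas (𝓡 n) ∞ M) (hψ : ψ ∈ IsManifold.maximalAtlas (𝓡 n) ∞ M)
    {x : EuclideanSpace ℝ (Fin n)} (hx : x ∈ ψ.target) (hx' : ψ.symm x ∈ φ.source)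
    (v : EuclideanSpace ℝ (Fin n)) :
    (mfderiv (𝓡 n) (𝓡 n) ψ.symm x v : EuclideanSpace ℝ (Fin n)) =
      mfderiv (𝓡 n) (𝓡 n) φ.symm (φ (ψ.symm x)) (fderiv ℝ (fun y => φ (ψ.symm y)) x v) := by
  have e : (ψ.symm : EuclideanSpace ℝ (Fin n) → M) =ᶠ[𝓝 x]
      φ.symm ∘ fun y => φ (ψ.symm y) := by
    have : ∀ᶠ y in 𝓝 x, ψ.symm y ∈ φ.source :=
      (ψ.continuousAt_symm hx).eventually (φ.open_source.mem_nhds hx')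
    filter_upwards [this] with y hy
    exact (φ.left_inv hy).symm
  have h1 : MDifferentiableAt (𝓡 n) (𝓡 n) φ.symm (φ (ψ.symm x)) :=
    (contMDiffAt_chart_symm hφ (φ.map_source hx')).mdifferentiableAt (by simp)
  have h2 : MDifferentiableAt (𝓡 n) (𝓡 n) (fun y => φ (ψ.symm y)) x :=
    (contDiffAt_transition hφ hψ hx hx').contMDiffAt.mdifferentiableAt (by simp)
  have h3 := congrArg (fun L : EuclideanSpace ℝ (Fin n) →L[ℝ] EuclideanSpace ℝ (Fin n) => L v)
    (mfderiv_comp x h1 h2)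
  rw [← mfderiv_eq_fderiv, e.mfderiv_eq]
  exact h3

theorem isUnit_det_transition {φ ψ : OpenPartialHomeomorph M (EuclideanSpace ℝ (Fin n))}
    (hφ : φ ∈ IsManifold.maximalAtlas (𝓡 n) ∞ M) (hψ : ψ ∈ IsManifold.maximalAtlas (𝓡 n) ∞ M)
    {x : EuclideanSpace ℝ (Fin n)} (hx : x ∈ ψ.target) (hx' : ψ.symm x ∈ φ.source) :
    IsUnit (Matrix.of fun a i => pd i (fun y => φ (ψ.symm y) a) x).det := by
  have hφx : φ.symm (φ (ψ.symm x)) = ψ.symm x := φ.left_inv hx'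
  have hσ : ContDiffAt ℝ ∞ (fun y => ψ (φ.symm y)) (φ (ψ.symm x)) :=
    contDiffAt_transition hψ hφ (φ.map_source hx') (by rw [hφx]; exact ψ.map_target hx)
  have hτ := contDiffAt_transition hφ hψ hx hx'
  refine Matrix.isUnit_det_of_left_inverse
    (B := Matrix.of fun a b => pd b (fun y => ψ (φ.symm y) a) (φ (ψ.symm x))) ?_
  ext a i
  -- The two transition maps are locally inverse, so the chain rule makes their Jacobians inverse
  -- matrices.
  have e : (fun y => ψ (φ.symm (φ (ψ.symm y))) a) =ᶠ[𝓝 x] fun y => y a := by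
    have : ∀ᶠ y in 𝓝 x, ψ.symm y ∈ φ.source :=
      (ψ.continuousAt_symm hx).eventually (φ.open_source.mem_nhds hx')
    filter_upwards [this, ψ.open_target.mem_nhds hx] with y hy hy'
    rw [φ.left_inv hy, ψ.right_inv hy']
  have hσa : ContDiffAt ℝ ∞ (fun y => ψ (φ.symm y) a) (φ (ψ.symm x)) :=
    (contDiffAt_piLp 2).1 hσ a
  have h := pd_comp (hσa.differentiableAt (by simp)) (hτ.differentiableAt (by simp)) i
  rw [pd_congr e, pd_apply (τ := fun y => y) differentiableAt_id] at h
  rw [Matrix.mul_apply]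
  refine h.symm.trans ?_
  simp [Matrix.one_apply]

theorem coords_eq_fderiv {φ ψ : OpenPartialHomeomorph M (EuclideanSpace ℝ (Fin n))}
    (hφ : φ ∈ IsManifold.maximalAtlas (𝓡 n) ∞ M) (hψ : ψ ∈ IsManifold.maximalAtlas (𝓡 n) ∞ M)
    {p : M} (hp : p ∈ φ.source) (hp' : p ∈ ψ.source) (v : TangentSpace (𝓡 n) p) :
    coords φ p v = fderiv ℝ (fun y => φ (ψ.symm y)) (ψ p) (coords ψ p v) := by
  have e : (φ : M → EuclideanSpace ℝ (Fin n)) =ᶠ[𝓝 p] (fun y => φ (ψ.symm y)) ∘ ψ := by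
    filter_upwards [ψ.open_source.mem_nhds hp'] with q hq
    simp [ψ.left_inv hq]
  have hτ : ContDiffAt ℝ ∞ (fun y => φ (ψ.symm y)) (ψ p) :=
    contDiffAt_transition hφ hψ (ψ.map_source hp') (by rwa [ψ.left_inv hp'])
  have h := congrArg (fun L : EuclideanSpace ℝ (Fin n) →L[ℝ] EuclideanSpace ℝ (Fin n) => L v)
    (mfderiv_comp p (hτ.contMDiffAt.mdifferentiableAt (by simp))
      ((contMDiffAt_chart hψ hp').mdifferentiableAt (by simp)))
  rw [← mfderiv_eq_fderiv]
  change (mfderiv (𝓡 n) (𝓡 n) φ p v : EuclideanSpace ℝ (Fin n)) = _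
  rw [e.mfderiv_eq]
  exact h

variable [IsManifold (𝓡 n) ∞ M]

theorem inner_mfderiv_symm (g : Metric n M)
    (φ : OpenPartialHomeomorph M (EuclideanSpace ℝ (Fin n))) (x v w : EuclideanSpace ℝ (Fin n)) :
    g.inner (φ.symm x) (mfderiv (𝓡 n) (𝓡 n) φ.symm x v) (mfderiv (𝓡 n) (𝓡 n) φ.symm x w) =
      ∑ a, ∑ b, v a * w b * coordMetric g φ x a b := by
  let D : EuclideanSpace ℝ (Fin n) →L[ℝ] TangentSpace (𝓡 n) (φ.symm x) :=
    mfderiv (𝓡 n) (𝓡 n) φ.symm x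
  have hD (v : EuclideanSpace ℝ (Fin n)) : D v = ∑ a, v a • coordVec φ a x := by
    conv_lhs => rw [← (EuclideanSpace.basisFun (Fin n) ℝ).sum_repr v]
    simp only [map_sum, map_smul, EuclideanSpace.basisFun_repr, EuclideanSpace.basisFun_apply]
    rfl
  change g.inner (φ.symm x) (D v) (D w) = _
  rw [hD, hD]
  simp only [map_sum, map_smul, sum_apply, smul_apply,
    smul_eq_mul, Finset.mul_sum]
  rw [Finset.sum_comm]
  refine Finset.sum_congr rfl fun a _ => Finset.sum_congr rfl fun b _ => ?_
  rw [coordMetric, Matrix.of_apply]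
  ring

theorem inner_mfderiv_symm_conformal (g : Metric n M)
    (φ : OpenPartialHomeomorph M (EuclideanSpace ℝ (Fin n))) {r : ℝ}
    {x : EuclideanSpace ℝ (Fin n)}
    (hG : coordMetric g φ x = r • (1 : Matrix (Fin n) (Fin n) ℝ))
    (v w : EuclideanSpace ℝ (Fin n)) :
    g.inner (φ.symm x) (mfderiv (𝓡 n) (𝓡 n) φ.symm x v) (mfderiv (𝓡 n) (𝓡 n) φ.symm x w) =
      r * ∑ a, v a * w a := by
  rw [inner_mfderiv_symm, hG, Finset.mul_sum]
  refine Finset.sum_congr rfl fun a _ => ?_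
  simp only [Matrix.smul_apply, Matrix.one_apply, smul_eq_mul, mul_ite, mul_one, mul_zero,
    Finset.sum_ite_eq, Finset.mem_univ, if_true]
  ring

theorem coordMetric_eq_pullback (g : Metric n M)
    {φ ψ : OpenPartialHomeomorph M (EuclideanSpace ℝ (Fin n))}
    (hφ : φ ∈ IsManifold.maximalAtlas (𝓡 n) ∞ M) (hψ : ψ ∈ IsManifold.maximalAtlas (𝓡 n) ∞ M)
    {x : EuclideanSpace ℝ (Fin n)} (hx : x ∈ ψ.target) (hx' : ψ.symm x ∈ φ.source) {r : ℝ}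
    (hG : coordMetric g φ (φ (ψ.symm x)) = r • (1 : Matrix (Fin n) (Fin n) ℝ)) (i j : Fin n) :
    coordMetric g ψ x i j = r * ∑ a, pd i (fun y => φ (ψ.symm y) a) x
      * pd j (fun y => φ (ψ.symm y) a) x := by
  have hpd (i a : Fin n) : pd i (fun y => φ (ψ.symm y) a) x =
      fderiv ℝ (fun y => φ (ψ.symm y)) x (EuclideanSpace.single i 1) a :=
    pd_apply ((contDiffAt_transition hφ hψ hx hx').differentiableAt (by simp)) i a
  simp only [hpd]
  rw [← inner_mfderiv_symm_conformal g φ hG]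
  -- All tangent spaces unfold to the model space; reading vectors there moves the base point along
  -- an equality without casts.
  have hQ (q : M) (hq : ψ.symm x = q) (v w : EuclideanSpace ℝ (Fin n)) :
      g.inner (ψ.symm x) v w = g.inner q v w := by
    subst hq; rfl
  rw [coordMetric, Matrix.of_apply]
  simp only [coordVec]
  have e := hQ _ (φ.left_inv hx').symm
    (mfderiv (𝓡 n) (𝓡 n) ψ.symm x (EuclideanSpace.single i (1 : ℝ) : EuclideanSpace ℝ (Fin n)))
    (mfderiv (𝓡 n) (𝓡 n) ψ.symm x (EuclideanSpace.single j (1 : ℝ) : EuclideanSpace ℝ (Fin n)))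
  refine e.trans ?_
  have e1 := mfderiv_symm_eq hφ hψ hx hx' (EuclideanSpace.single i 1)
  have e2 := mfderiv_symm_eq hφ hψ hx hx' (EuclideanSpace.single j 1)
  exact congrArg₂ (fun v w : EuclideanSpace ℝ (Fin n) => g.inner (φ.symm (φ (ψ.symm x))) v w) e1 e2

theorem inner_eq_coords (g : Metric n M) {φ : OpenPartialHomeomorph M (EuclideanSpace ℝ (Fin n))}
    (hφ : φ ∈ IsManifold.maximalAtlas (𝓡 n) ∞ M) {p : M} (hp : p ∈ φ.source) {r : ℝ}
    (hG : coordMetric g φ (φ p) = r • (1 : Matrix (Fin n) (Fin n) ℝ))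
    (v w : TangentSpace (𝓡 n) p) :
    g.inner p v w = r * ∑ a, coords φ p v a * coords φ p w a := by
  rw [← inner_mfderiv_symm_conformal g φ hG]
  have e : φ.symm ∘ φ =ᶠ[𝓝 p] id := by
    filter_upwards [φ.open_source.mem_nhds hp] with q hq using φ.left_inv hq
  have hv (v : TangentSpace (𝓡 n) p) : (v : EuclideanSpace ℝ (Fin n)) =
      mfderiv (𝓡 n) (𝓡 n) φ.symm (φ p) (coords φ p v) := by
    have h := congrArg (fun L : EuclideanSpace ℝ (Fin n) →L[ℝ] EuclideanSpace ℝ (Fin n) => L v)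
      (mfderiv_comp p
        ((contMDiffAt_chart_symm hφ (φ.map_source hp)).mdifferentiableAt (by simp))
        ((contMDiffAt_chart hφ hp).mdifferentiableAt (by simp)))
    refine Eq.trans ?_ h
    rw [e.mfderiv_eq, mfderiv_id]
    rfl
  have hQ (q : M) (hq : p = q) (v w : EuclideanSpace ℝ (Fin n)) :
      g.inner p v w = g.inner q v w := by
    subst hq; rfl
  refine (hQ _ (φ.left_inv hp).symm v w).trans ?_
  exact congrArg₂ (fun v w : EuclideanSpace ℝ (Fin n) => g.inner (φ.symm (φ p)) v w) (hv v) (hv w)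

end Charts

/-! ### Spectrum of a scalar plus a rank-one operator. -/

section RankOnePerturbation

variable {V : Type*} [AddCommGroup V] [Module ℝ V] {T : Module.End ℝ V}
  {α : Module.Dual ℝ V} {ν : V} {s m : ℝ}

theorem hasEigenvector_rankOne (hT : ∀ v, T v = (s * α v) • ν + m • v) (hν : α ν = 1) :
    T.HasEigenvector (m + s) ν := by
  refine ⟨Module.End.mem_eigenspace_iff.2 ?_, fun h => by simp [h] at hν⟩
  rw [hT, hν, mul_one, ← add_smul, add_comm]

theorem hasEigenvalue_rankOne (hT : ∀ v, T v = (s * α v) • ν + m • v) (hν : α ν = 1) {r : ℝ}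
    (hr : T.HasEigenvalue r) : r = m + s ∨ r = m := by
  obtain ⟨v, hv, hv0⟩ := hr.exists_hasEigenvector
  rw [Module.End.mem_eigenspace_iff, hT] at hv
  -- Applying `α` gives `(s + m) α v = r α v`, which settles `r` unless `α v = 0`; in that case `T v
  -- = m v`.
  have h := congrArg α hv
  simp only [map_add, map_smul, hν, smul_eq_mul, mul_one] at h
  by_cases hα : α v = 0
  · right
    rw [hα, mul_zero, zero_smul, zero_add] at hv
    exact (smul_left_injective ℝ hv0 hv).symm
  · left
    refine mul_right_cancel₀ hα ?_
    linarith

theorem eigenspace_rankOne_ker (hT : ∀ v, T v = (s * α v) • ν + m • v) (hν : α ν = 1)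
    (hs : s ≠ 0) : T.eigenspace m = LinearMap.ker α := by
  have hν0 : ν ≠ 0 := fun h => by simp [h] at hν
  ext v
  rw [Module.End.mem_eigenspace_iff, hT, LinearMap.mem_ker, add_eq_right]
  simp [hs, hν0]

theorem eigenspace_rankOne_span (hT : ∀ v, T v = (s * α v) • ν + m • v) (hν : α ν = 1)
    (hs : s ≠ 0) : T.eigenspace (m + s) = Submodule.span ℝ {ν} := by
  ext v
  rw [Module.End.mem_eigenspace_iff, hT, Submodule.mem_span_singleton]
  constructor
  · intro h
    refine ⟨α v, smul_right_injective V hs ?_⟩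
    simp only [smul_smul]
    rw [add_smul, add_comm] at h
    exact add_left_cancel h
  · rintro ⟨a, rfl⟩
    rw [map_smul, hν, smul_eq_mul, mul_one, add_smul, smul_smul, smul_smul, add_comm]

theorem finrank_ker_dual [FiniteDimensional ℝ V] (hα : α ≠ 0) :
    Module.finrank ℝ (LinearMap.ker α) = Module.finrank ℝ V - 1 := by
  have h := LinearMap.finrank_range_add_finrank_ker α
  rw [LinearMap.range_eq_top.2 (LinearMap.surjective hα), finrank_top, Module.finrank_self] at h
  omega

end RankOnePerturbation

/-! ### The Ricci tensor as a combination of `dF ⊗ dF` and `g`. -/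

section Main

theorem sum_bilinear_change {ι : Type*} [Fintype ι] (H J : ι → ι → ℝ) (v w : ι → ℝ) :
    ∑ i, ∑ j, (∑ a, ∑ b, H a b * J i a * J j b) * v i * w j =
      ∑ a, ∑ b, H a b * ((∑ i, v i * J i a) * ∑ j, w j * J j b) := by
  simp only [Finset.sum_mul, Finset.mul_sum]
  have e (i : ι) : ∑ j, ∑ a, ∑ b, H a b * J i a * J j b * v i * w j =
      ∑ a, ∑ b, ∑ j, H a b * J i a * J j b * v i * w j := by
    rw [Finset.sum_comm]
    exact Finset.sum_congr rfl fun a _ => Finset.sum_comm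
  rw [Finset.sum_congr rfl fun i _ => e i, Finset.sum_comm]
  refine Finset.sum_congr rfl fun a _ => ?_
  rw [Finset.sum_comm]
  refine Finset.sum_congr rfl fun b _ => ?_
  rw [Finset.sum_comm]
  exact Finset.sum_congr rfl fun i _ => Finset.sum_congr rfl fun j _ => by ring

variable {n : ℕ} {M : Type*} [TopologicalSpace M] [ChartedSpace (EuclideanSpace ℝ (Fin n)) M]
  [IsManifold (𝓡 n) ∞ M]

theorem sharp_inner (g : Metric n M) (p : M) (α : Module.Dual ℝ (TangentSpace (𝓡 n) p))
    (w : TangentSpace (𝓡 n) p) : g.inner p (sharp g p α) w = α w :=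
  LinearMap.BilinForm.apply_toDual_symm_apply (hB := metricForm_nondegenerate g p) α w

/-- On a locally conformally flat steady soliton of dimension at least three, the Ricci tensor is
a combination of `dF ⊗ dF` and the metric wherever `dF ≠ 0`. -/
theorem exists_ricci_eq (hn : 3 ≤ n) {g : Metric n M} {F : M → ℝ}
    (hsol : IsGradientSteadySoliton g F) (hflat : IsLocallyConformallyFlat g) {p : M}
    (hp : differential (n := n) F p ≠ 0) :
    ∃ A m : ℝ, ∀ v w : TangentSpace (𝓡 n) p, ricci g p v w
      = A * (differential F p v * differential F p w) + m * g.inner p v w := by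
  obtain ⟨φ, hφ, hpφ, u, hu, hG⟩ := hflat p
  set f := F ∘ φ.symm with hf
  set z := φ p with hz
  have hzt : z ∈ φ.target := φ.map_source hpφ
  have hnhds : φ.target ∈ 𝓝 z := φ.open_target.mem_nhds hzt
  have hus (x : EuclideanSpace ℝ (Fin n)) (hx : x ∈ φ.target) : ContDiffAt ℝ ∞ u x :=
    hu.contDiffAt (φ.open_target.mem_nhds hx)
  have hfs : ContDiffAt ℝ ∞ f z :=
    (hsol.smooth.contMDiffAt.comp z (contMDiffAt_chart_symm hφ hzt)).contDiffAt
  have huz := hus z hzt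
  have hGev (x : EuclideanSpace ℝ (Fin n)) (hx : x ∈ φ.target) : coordMetric g φ =ᶠ[𝓝 x]
      fun y => Real.exp (2 * u y) • (1 : Matrix (Fin n) (Fin n) ℝ) :=
    Filter.eventuallyEq_of_mem (φ.open_target.mem_nhds hx) hG
  have hdF (v : TangentSpace (𝓡 n) p) : differential F p v = ∑ a, coords φ p v a * pd a f z :=
    differential_eq_fderiv hφ hsol.smooth hpφ v
  have hdu (a : Fin n) : DifferentiableAt ℝ (pd a u) z :=
    (contDiffAt_pd huz a).differentiableAt (by simp)
  set ρ : EuclideanSpace ℝ (Fin n) → ℝ := fun y =>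
    ∑ i, pd i (pd i u) y + ((n : ℝ) - 2) * ∑ i, pd i u y * pd i u y with hρ
  have hdρ : DifferentiableAt ℝ ρ z :=
    (DifferentiableAt.fun_sum fun a _ =>
      (contDiffAt_pd (contDiffAt_pd huz a) a).differentiableAt (by simp)).add
      ((DifferentiableAt.fun_sum fun a _ => (hdu a).mul (hdu a)).const_mul _)
  -- The equation is needed on the whole chart domain, since it will be differentiated at `z`.
  have hsolφ (y : EuclideanSpace ℝ (Fin n)) (hy : y ∈ φ.target) (i j : Fin n) :
      -((n : ℝ) - 2) * (pd i (pd j u) y - pd i u y * pd j u y)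
        - (if i = j then ρ y else 0) = conformalHess u f i j y := by
    rw [← hessCoord_conformal ((hus y hy).differentiableAt (by simp)) (hGev y hy),
      ← hsol.eq φ hφ y hy, ricciCoord_conformal (hus y hy) (hGev y hy)]
  obtain ⟨θ, hθ⟩ := conformal_soliton_tensor huz hfs hdρ
    (Filter.eventually_of_mem hnhds hsolφ)
  obtain ⟨a, b, hab⟩ := eq_rankOne_add_scalar hn
    (B := fun j k => pd j (pd k u) z - pd j u z * pd k u z) (f := fun i => pd i f z) (θ := θ)
    (fun j k => by simp only [pd_comm huz j k, mul_comm])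
    (fun h0 => hp (LinearMap.ext fun v => by
      rw [hdF]
      simp [fun a => show pd a f z = 0 from congrFun h0 a]))
    hθ
  have hH (i j : Fin n) : conformalHess u f i j z =
      -((n : ℝ) - 2) * a * (pd i f z * pd j f z)
        + if i = j then -((n : ℝ) - 2) * b - ρ z else 0 := by
    rw [← hsolφ z hzt, hab i j]
    split_ifs <;> ring
  set ψ := chartAt (EuclideanSpace ℝ (Fin n)) p with hψdef
  have hψ : ψ ∈ IsManifold.maximalAtlas (𝓡 n) ∞ M := IsManifold.chart_mem_maximalAtlas p
  have hpψ : p ∈ ψ.source := mem_chart_source _ p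
  have hxt : ψ p ∈ ψ.target := ψ.map_source hpψ
  have hψp : ψ.symm (ψ p) = p := ψ.left_inv hpψ
  have hxs : ψ.symm (ψ p) ∈ φ.source := by rwa [hψp]
  have hτp : φ (ψ.symm (ψ p)) = z := by rw [hψp]
  have hτ := contDiffAt_transition hφ hψ hxt hxs
  have hev : ∀ᶠ y in 𝓝 (ψ p), y ∈ ψ.target ∧ ψ.symm y ∈ φ.source :=
    (Filter.Eventually.and (ψ.open_target.mem_nhds hxt)
      ((ψ.continuousAt_symm hxt).eventually (φ.open_source.mem_nhds hxs)))
  -- The soliton equation in the preferred chart `ψ` turns Ricci into a Hessian, which is then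
  -- computed in the conformal chart `φ`.
  have hess (i j : Fin n) : ricciCoord (coordMetric g ψ) i j (ψ p) =
      ∑ a, ∑ b, conformalHess u f a b z * pd i (fun y => φ (ψ.symm y) a) (ψ p)
        * pd j (fun y => φ (ψ.symm y) b) (ψ p) := by
    have h := hessCoord_conformal_pullback (G := coordMetric g ψ) (u := u) (f := f)
      (h := F ∘ ψ.symm) hτ (by rwa [hτp]) (by rwa [hτp])
      (by
        filter_upwards [hev] with y hy
        simp [hf, φ.left_inv hy.2])
      (fun i j => by
        filter_upwards [hev] with y hy
        exact coordMetric_eq_pullback g hφ hψ hy.1 hy.2 (hG _ (φ.map_source hy.2)) i j)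
      (isUnit_det_transition hφ hψ hxt hxs) i j
    rw [hsol.eq ψ hψ _ hxt, h, hτp]
  have hcoords (v : TangentSpace (𝓡 n) p) (a : Fin n) : coords φ p v a =
      ∑ i, coords ψ p v i * pd i (fun y => φ (ψ.symm y) a) (ψ p) := by
    rw [coords_eq_fderiv hφ hψ hpφ hpψ]
    let P : EuclideanSpace ℝ (Fin n) →L[ℝ] ℝ := EuclideanSpace.proj a
    simp only [pd_apply (hτ.differentiableAt (by simp))]
    exact clm_apply_eq_sum (P ∘L fderiv ℝ (fun y => φ (ψ.symm y)) (ψ p)) (coords ψ p v)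
  have hricci (v w : TangentSpace (𝓡 n) p) : ricci g p v w =
      ∑ a, ∑ b, conformalHess u f a b z * (coords φ p v a * coords φ p w b) := by
    change ∑ i, ∑ j, ricciCoord (coordMetric g ψ) i j (ψ p) * coords ψ p v i * coords ψ p w j = _
    simp only [hess, hcoords]
    exact sum_bilinear_change (fun a b => conformalHess u f a b z)
      (fun i a => pd i (fun y => φ (ψ.symm y) a) (ψ p)) (coords ψ p v) (coords ψ p w)
  -- The coefficient of `δ` is divided by `e^{2u}` because `δ = e^{-2u} g`.
  refine ⟨-((n : ℝ) - 2) * a, (-((n : ℝ) - 2) * b - ρ z) / Real.exp (2 * u z), fun v w => ?_⟩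
  rw [hricci, inner_eq_coords g hφ hpφ (hG z hzt), hdF, hdF]
  have h0 := Real.exp_ne_zero (2 * u z)
  simp only [hH, add_mul, ite_mul, zero_mul, Finset.sum_add_distrib, Finset.sum_ite_eq,
    Finset.mem_univ, if_true]
  congr 1
  · simp only [Finset.sum_mul, Finset.mul_sum]
    rw [Finset.sum_comm]
    exact Finset.sum_congr rfl fun i _ => Finset.sum_congr rfl fun j _ => by ring
  · rw [← mul_assoc, div_mul_cancel₀ _ h0, Finset.mul_sum]

end Main

end SteadySoliton

end

/-! ### Eigenvalues of the Ricci endomorphism. -/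

theorem lemma3p2 {n : ℕ} (hn : 3 ≤ n) {M : Type*} [TopologicalSpace M]
    [ChartedSpace (EuclideanSpace ℝ (Fin n)) M] [IsManifold (𝓡 n) ∞ M]
    (g : SteadySoliton.Metric n M) (F : M → ℝ)
    (hsol : SteadySoliton.IsGradientSteadySoliton g F)
    (hflat : SteadySoliton.IsLocallyConformallyFlat g)
    (c : ℝ) (hc : SteadySoliton.IsRegularValue n F c) (p : M) (hp : F p = c) :
    ∃ l m : ℝ,
      -- `∇F / |∇F|` is an eigenvector with eigenvalue `l`
      (SteadySoliton.ricciEnd g p).HasEigenvector l (SteadySoliton.unitNormal g F p) ∧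
      -- either `l` is the only eigenvalue, or there are exactly two, `l` and `m`, of
      -- multiplicities `1` and `n - 1`
      ((m = l ∧ ∀ ν : ℝ, (SteadySoliton.ricciEnd g p).HasEigenvalue ν ↔ ν = l) ∨
        (m ≠ l ∧ (∀ ν : ℝ, (SteadySoliton.ricciEnd g p).HasEigenvalue ν ↔ ν = l ∨ ν = m) ∧
          Module.finrank ℝ ((SteadySoliton.ricciEnd g p).eigenspace l) = 1 ∧
          Module.finrank ℝ ((SteadySoliton.ricciEnd g p).eigenspace m) = n - 1)) ∧
      -- the components of the Ricci tensor in an adapted orthonormal basis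
      SteadySoliton.ricci g p (SteadySoliton.unitNormal g F p)
        (SteadySoliton.unitNormal g F p) = l ∧
      ∀ e : Fin (n - 1) → TangentSpace (𝓡 n) p,
        (∀ a b, g.inner p (e a) (e b) = if a = b then 1 else 0) →
        (∀ a, SteadySoliton.differential F p (e a) = 0) →
        (∀ b, SteadySoliton.ricci g p (SteadySoliton.unitNormal g F p) (e b) = 0) ∧
        (∀ a b, SteadySoliton.ricci g p (e a) (e b) = if a = b then m else 0) := by
  have hd : SteadySoliton.differential (n := n) F p ≠ 0 := fun h =>
    hc p hp (ContinuousLinearMap.coe_injective h)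
  obtain ⟨A, m, hR⟩ := SteadySoliton.exists_ricci_eq hn hsol hflat hd
  set X := SteadySoliton.grad g F p with hX
  set ν := SteadySoliton.unitNormal g F p with hν
  set N := g.inner p X X with hN
  have hXv (v : TangentSpace (𝓡 n) p) : g.inner p X v = SteadySoliton.differential F p v :=
    SteadySoliton.sharp_inner g p _ v
  have hX0 : X ≠ 0 := fun h => hd (LinearMap.ext fun v => by rw [← hXv, h]; simp)
  have hN0 : 0 < N := g.pos p X hX0
  have hs0 : Real.sqrt N ≠ 0 := (Real.sqrt_pos.2 hN0).ne'
  have hsN : Real.sqrt N * Real.sqrt N = N := Real.mul_self_sqrt hN0.le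
  have hνX : ν = (Real.sqrt N)⁻¹ • X := rfl
  have hXν : X = Real.sqrt N • ν := by rw [hνX, smul_inv_smul₀ hs0]
  -- `α = g(ν, ·)` is the normalised differential: `α ν = 1`, and its kernel is the tangent space of
  -- the level set.
  set α : Module.Dual ℝ (TangentSpace (𝓡 n) p) :=
    (Real.sqrt N)⁻¹ • SteadySoliton.differential F p with hα
  have hdα (v : TangentSpace (𝓡 n) p) :
      SteadySoliton.differential F p v = Real.sqrt N * α v := by
    rw [hα, LinearMap.smul_apply, smul_eq_mul, mul_inv_cancel_left₀ hs0]
  have hνv (v : TangentSpace (𝓡 n) p) : g.inner p ν v = α v := by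
    rw [hνX, map_smul, smul_apply, hXv]; rfl
  have hανv : α ν = 1 := by
    rw [hα, LinearMap.smul_apply, ← hXv, hνX, map_smul, ← hN, smul_eq_mul, smul_eq_mul,
      ← mul_assoc, ← mul_inv, hsN, inv_mul_cancel₀ hN0.ne']
  have hT (v : TangentSpace (𝓡 n) p) :
      SteadySoliton.ricciEnd g p v = (A * N * α v) • ν + m • v := by
    have e : SteadySoliton.ricci g p v
        = (A * SteadySoliton.differential F p v) • SteadySoliton.differential F p
          + m • (SteadySoliton.sharp g p).symm v := by
      refine LinearMap.ext fun w => ?_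
      have := SteadySoliton.sharp_inner g p ((SteadySoliton.sharp g p).symm v) w
      rw [LinearEquiv.apply_symm_apply] at this
      rw [hR, LinearMap.add_apply, LinearMap.smul_apply, LinearMap.smul_apply, ← this,
        smul_eq_mul, smul_eq_mul, mul_assoc]
    change SteadySoliton.sharp g p (SteadySoliton.ricci g p v) = _
    rw [e, map_add, map_smul, map_smul, LinearEquiv.apply_symm_apply]
    change (A * SteadySoliton.differential F p v) • X + _ = _
    rw [hXν, smul_smul, hdα]
    congr 2
    linear_combination A * α v * hsN
  have hfr : Module.finrank ℝ (TangentSpace (𝓡 n) p) = n :=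
    finrank_euclideanSpace_fin (𝕜 := ℝ) (n := n)
  have hα0 : α ≠ 0 := fun h => by simp [h] at hανv
  have hker : Module.finrank ℝ (LinearMap.ker α) = n - 1 := by
    rw [SteadySoliton.finrank_ker_dual hα0, hfr]
  have hev := SteadySoliton.hasEigenvector_rankOne hT hανv
  -- With `N = |∇F|²`, the eigenvalues coincide exactly when `A * N = 0`.
  refine ⟨m + A * N, m, hev, ?_, ?_, fun e he hte => ⟨fun b => ?_, fun a b => ?_⟩⟩
  · by_cases hA : A * N = 0
    · refine Or.inl ⟨by rw [hA, add_zero], fun r => ⟨fun hr => ?_, ?_⟩⟩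
      · rcases SteadySoliton.hasEigenvalue_rankOne hT hανv hr with h | h
        · exact h
        · rw [h, hA, add_zero]
      · rintro rfl
        exact Module.End.hasEigenvalue_of_hasEigenvector hev
    · have hm := SteadySoliton.eigenspace_rankOne_ker hT hανv hA
      have hl := SteadySoliton.eigenspace_rankOne_span hT hανv hA
      refine Or.inr ⟨fun h => hA (by linarith),
        fun r => ⟨SteadySoliton.hasEigenvalue_rankOne hT hανv, ?_⟩, ?_, ?_⟩
      · rintro (rfl | rfl)
        · exact Module.End.hasEigenvalue_of_hasEigenvector hev
        -- That `m` is an eigenvalue at all comes from the dimension count: its eigenspace is `ker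
        -- α`, of dimension `n - 1 ≥ 2`.
        · intro hbot
          have h0 := hker
          rw [← hm] at h0
          have hbot' : (SteadySoliton.ricciEnd g p).eigenspace r = ⊥ := hbot
          rw [hbot', finrank_bot] at h0
          omega
      · rw [hl, finrank_span_singleton hev.2]
      · rw [hm, hker]
  · rw [hR, hνv, hανv, hdα, hανv, mul_one, mul_one, hsN, add_comm]
  · rw [hR, hte, hνv, hα, LinearMap.smul_apply, hte, smul_zero, mul_zero, mul_zero, mul_zero,
      add_zero]
  · rw [hR, hte, zero_mul, mul_zero, zero_add, he]
    split_ifs <;> simp
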